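/- Let $(X,d)$ be a compact metric space and $T:X\to X$ a continuous map. Write $d_n(x,y)=\max_{0\le i\le n-1}d(T^ix,T^iy)$, $B_n(x,\epsilon)=\{y: d_n(x,y)<\epsilon\}$, and $S_n\varphi(x)=\sum_{i=0}^{n-1}\varphi(T^ix)$ for $\varphi\in C(X)$, the real-valued continuous functions on $X$. Assume that $(X,d,T)$ has the specification property: for every $\epsilon>0$ there is an integer $m=m(\epsilon)$ such that for any finite collection of intervals $I_j=[a_j,b_j]\subset\mathbb N$, $j=1,\dots,k$, with $a_{j+1}-b_j\ge m(\epsilon)$ for $j=1,\dots,k-1$, and any $x_1,\dots,x_k\in X$, there is $x\in X$ with $d(T^{p+a_j}x,T^px_j)<\epsilon$ for all $0\le p\le b_j-a_j$ and all $1\le j\le k$. For $\varphi\in C(X)$ the classical topological pressure is $$P_{top}(\varphi)=\lim_{\epsilon\to0}\liminf_{n\to\infty}\frac1n\log\sup_{E}\sum_{x\in E}e^{S_n\varphi(x)},$$ where the supremum is over all sets $E\subset X$ that are $(n,\epsilon)$-separated, i.e. $d_n(x,y)>\epsilon$ for all distinct $x,y\in E$. For $Z\subset X$ the Pesin–Pitskel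 topological pressure is $P(Z,\varphi)=\lim_{\epsilon\to0}P(Z,\varphi,\epsilon)$, where $$P(Z,\varphi,\epsilon)=\inf\{t\in\mathbb R:M(Z,t,\varphi,\epsilon)=0\}=\sup\{t\in\mathbb R:M(Z,t,\varphi,\epsilon)=\infty\},$$ $$M(Z,t,\varphi,\epsilon)=\lim_{n\to\infty}\inf_{\mathcal C}\sum_{B_m(x,\epsilon)\in\mathcal C}\exp\Big(-tm+\sup_{y\in B_m(x,\epsilon)}S_m\varphi(y)\Big),$$ and the infimum is over all finite or countable covers $\mathcal C$ of $Z$ by balls $B_m(x,\epsilon)$ with $x\in X$ and $m\ge n$. Both pressures take values in $[-\infty,\infty]$. Let $z_0\in X$ be a non-transitive point, i.e. $\overline{\{T^nz_0:n\ge0\}}\ne X$, and put $E(z_0)=\{x\in X: z_0\notin\overline{\{T^nx:n\ge0\}}\}$. Then for every $\varphi\in C(X)$, either $E(z_0)=\emptyset$ or $$P(E(z_0),\varphi)=P_{top}(\varphi).$$ -/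

import Mathlib

open Set Filter Topology
open scoped ENNReal

noncomputable section

namespace TopDyn

variable {X : Type*} [MetricSpace X]

/-- The forward orbit `{x, T x, T² x, …}` of `x`. -/
def forwardOrbit (T : X → X) (x : X) : Set X := range fun n : ℕ => T^[n] x

/-- A point is non-transitive if the closure of its forward orbit is not the whole space. -/
def IsNonTransitive (T : X → X) (z : X) : Prop := closure (forwardOrbit T z) ≠ univ

/-- The non-dense orbit set `E(z₀)`: the points whose forward orbit does not accumulate at or
pass through `z₀`, that is, `z₀` is not in the closure of the forward orbit. -/
def nonDenseOrbitSet (T : X → X) (z₀ : X) : Set X := {x | z₀ ∉ closure (forwardOrbit T x)}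

/-- The specification property: for every `ε > 0` there is a gap length `m` such that any finite
collection of orbit segments, prescribed on integer intervals `[a j, b j]`, `j < k`, with gaps
`a (j + 1) - b j ≥ m`, is `ε`-shadowed by the orbit of one point. (The values of `a`, `b`, `x` at
indices `≥ k` play no role.) -/
def HasSpecification (T : X → X) : Prop :=
  ∀ ε : ℝ, 0 < ε → ∃ m : ℕ, ∀ (k : ℕ) (a b : ℕ → ℕ) (x : ℕ → X),
    (∀ j, j < k → a j ≤ b j) →
    (∀ j, j + 1 < k → b j + m ≤ a (j + 1)) →
    ∃ y : X, ∀ j, j < k → ∀ p, p ≤ b j - a j → dist (T^[p + a j] y) (T^[p] (x j)) < ε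

/-- The Bowen metric `d_n(x, y) = max_{0 ≤ i ≤ n - 1} d(T^i x, T^i y)` (equal to `0` if `n = 0`;
a supremum over a finite index set). -/
def bowenDist (T : X → X) (n : ℕ) (x y : X) : ℝ :=
  ⨆ i : Fin n, dist (T^[(i : ℕ)] x) (T^[(i : ℕ)] y)

/-- The open Bowen ball `B_n(x, ε)`. -/
def bowenBall (T : X → X) (n : ℕ) (x : X) (ε : ℝ) : Set X := {y | bowenDist T n x y < ε}

/-- `E` is `(n, ε)`-separated: distinct points of `E` have Bowen distance `> ε`. -/
def IsSeparatedSet (T : X → X) (n : ℕ) (ε : ℝ) (E : Set X) : Prop :=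
  ∀ x ∈ E, ∀ y ∈ E, x ≠ y → ε < bowenDist T n x y

/-- `P(φ, n, ε)`: the supremum of `∑_{x ∈ E} exp (S_n φ x)` over the `(n, ε)`-separated sets `E`,
with values in `[0, ∞]`. -/
def separatedSum (T : X → X) (φ : X → ℝ) (n : ℕ) (ε : ℝ) : ℝ≥0∞ :=
  ⨆ (E : Set X) (_ : IsSeparatedSet T n ε E),
    ∑' x : E, ENNReal.ofReal (Real.exp (birkhoffSum T φ n x))

/-- `liminf_{n → ∞} (1 / n) log P(φ, n, ε)`. -/
def topPressureAt (T : X → X) (φ : X → ℝ) (ε : ℝ) : EReal :=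
  liminf (fun n : ℕ => ENNReal.log (separatedSum T φ n ε) / (n : EReal)) atTop

/-- The classical topological pressure
`P_top(φ) = lim_{ε → 0} liminf_{n → ∞} (1 / n) log P(φ, n, ε)`, with values in `[-∞, ∞]`.
The limit over `ε → 0⁺` exists by `tendsto_topPressureAt`, so the `limsup` over `ε` is that limit. -/
def topPressure (T : X → X) (φ : X → ℝ) : EReal :=
  limsup (fun ε : ℝ => topPressureAt T φ ε) (𝓝[>] 0)

/-- `C` codes a finite or countable cover of `Z` by Bowen balls `B_m(x, ε)`, `(x, m) ∈ C`, all of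
them with `m ≥ n`. -/
def IsBowenCover (T : X → X) (Z : Set X) (n : ℕ) (ε : ℝ) (C : Set (X × ℕ)) : Prop :=
  C.Countable ∧ (∀ p ∈ C, n ≤ p.2) ∧ Z ⊆ ⋃ p ∈ C, bowenBall T p.2 p.1 ε

/-- `exp (-t m + sup_{y ∈ B_m(x, ε)} S_m φ y)`, as an element of `[0, ∞]`. -/
def ballWeight (T : X → X) (φ : X → ℝ) (t ε : ℝ) (x : X) (m : ℕ) : ℝ≥0∞ :=
  ENNReal.ofReal (Real.exp (-t * m + sSup (birkhoffSum T φ m '' bowenBall T m x ε)))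

/-- `M(Z, t, φ, n, ε)`. -/
def coverSum (T : X → X) (Z : Set X) (φ : X → ℝ) (t : ℝ) (n : ℕ) (ε : ℝ) : ℝ≥0∞ :=
  ⨅ (C : Set (X × ℕ)) (_ : IsBowenCover T Z n ε C), ∑' p : C, ballWeight T φ t ε p.1.1 p.1.2

/-- `M(Z, t, φ, ε) = lim_{n → ∞} M(Z, t, φ, n, ε)`; the limit is the supremum because the sequence
is non-decreasing, see `tendsto_coverSum`. -/
def coverLimit (T : X → X) (Z : Set X) (φ : X → ℝ) (t ε : ℝ) : ℝ≥0∞ :=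
  ⨆ n : ℕ, coverSum T Z φ t n ε

/-- `P(Z, φ, ε) = inf {t | M(Z, t, φ, ε) = 0}`, with values in `[-∞, ∞]`. It is also
`sup {t | M(Z, t, φ, ε) = ∞}`, see `pressureAt_eq_sSup`. -/
def pressureAt (T : X → X) (Z : Set X) (φ : X → ℝ) (ε : ℝ) : EReal :=
  sInf ((fun t : ℝ => (t : EReal)) '' {t : ℝ | coverLimit T Z φ t ε = 0})

/-- The Pesin–Pitskel topological pressure `P(Z, φ) = lim_{ε → 0} P(Z, φ, ε)` of an arbitrary
subset `Z`. For continuous `φ` on a compact space the limit over `ε → 0⁺` exists by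
`tendsto_pressureAt`, so the `limsup` over `ε` is that limit. -/
def pressure (T : X → X) (Z : Set X) (φ : X → ℝ) : EReal :=
  limsup (fun ε : ℝ => pressureAt T Z φ ε) (𝓝[>] 0)

/-! ### The limits and the critical value in the definitions above are well defined -/

theorem bowenDist_lt_iff (T : X → X) (n : ℕ) (x y : X) {ε : ℝ} (hε : 0 < ε) :
    bowenDist T n x y < ε ↔ ∀ i, i < n → dist (T^[i] x) (T^[i] y) < ε := by
  unfold bowenDist
  rcases Nat.eq_zero_or_pos n with rfl | hn
  · simp [hε]
  · have : Nonempty (Fin n) := ⟨⟨0, hn⟩⟩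
    constructor
    · intro h i hi
      exact lt_of_le_of_lt (le_ciSup (f := fun i : Fin n => dist (T^[(i : ℕ)] x) (T^[(i : ℕ)] y))
        (Set.finite_range _).bddAbove ⟨i, hi⟩) h
    · intro h
      obtain ⟨i, hi⟩ := exists_eq_ciSup_of_finite
        (f := fun i : Fin n => dist (T^[(i : ℕ)] x) (T^[(i : ℕ)] y))
      rw [← hi]
      exact h i i.2

theorem topPressureAt_anti (T : X → X) (φ : X → ℝ) : Antitone (topPressureAt T φ) := by
  intro ε ε' h
  refine liminf_le_liminf (Eventually.of_forall fun n => ?_)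
  refine EReal.div_le_div_right_of_nonneg (by positivity) (ENNReal.log_monotone ?_)
  refine iSup_mono fun E => iSup_mono' fun hE => ⟨?_, le_rfl⟩
  exact fun x hx y hy hxy => lt_of_le_of_lt h (hE x hx y hy hxy)

theorem tendsto_topPressureAt (T : X → X) (φ : X → ℝ) :
    Tendsto (topPressureAt T φ) (𝓝[>] 0) (𝓝 (topPressure T φ)) := by
  have h := (topPressureAt_anti T φ).tendsto_nhdsGT 0
  have h2 := h.limsup_eq
  unfold topPressure
  rw [h2]
  exact h

theorem coverSum_mono (T : X → X) (Z : Set X) (φ : X → ℝ) (t ε : ℝ) :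
    Monotone fun n => coverSum T Z φ t n ε := by
  intro n n' h
  refine iInf_mono fun C => iInf_mono' fun hC => ⟨?_, le_rfl⟩
  exact ⟨hC.1, fun p hp => h.trans (hC.2.1 p hp), hC.2.2⟩

theorem tendsto_coverSum (T : X → X) (Z : Set X) (φ : X → ℝ) (t ε : ℝ) :
    Tendsto (fun n => coverSum T Z φ t n ε) atTop (𝓝 (coverLimit T Z φ t ε)) :=
  tendsto_atTop_iSup (coverSum_mono T Z φ t ε)

theorem coverSum_le_of_lt (T : X → X) (Z : Set X) (φ : X → ℝ) {t s : ℝ} (hts : t < s) (n : ℕ)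
    (ε : ℝ) : coverSum T Z φ s n ε ≤
      ENNReal.ofReal (Real.exp (-(s - t) * n)) * coverSum T Z φ t n ε := by
  have hc0 : ENNReal.ofReal (Real.exp (-(s - t) * n)) ≠ 0 := by simp [Real.exp_pos]
  unfold coverSum
  rw [ENNReal.mul_iInf_of_ne hc0 ENNReal.ofReal_ne_top]
  refine le_iInf fun C => ?_
  rw [ENNReal.mul_iInf_of_ne hc0 ENNReal.ofReal_ne_top]
  refine le_iInf fun hC => ?_
  refine (iInf₂_le C hC).trans ?_
  rw [← ENNReal.tsum_mul_left]
  refine ENNReal.tsum_le_tsum fun p => ?_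
  unfold ballWeight
  rw [← ENNReal.ofReal_mul (Real.exp_pos _).le, ← Real.exp_add]
  refine ENNReal.ofReal_le_ofReal (Real.exp_le_exp.2 ?_)
  have h1 : (n : ℝ) ≤ (p.1.2 : ℝ) := by exact_mod_cast hC.2.1 p.1 p.2
  nlinarith [mul_le_mul_of_nonneg_left h1 (sub_pos.2 hts).le]

theorem coverLimit_eq_zero_of_lt (T : X → X) (Z : Set X) (φ : X → ℝ) {t s ε : ℝ} (hts : t < s)
    (h : coverLimit T Z φ t ε ≠ ∞) : coverLimit T Z φ s ε = 0 := by
  have h1 : Tendsto (fun n : ℕ => ENNReal.ofReal (Real.exp (-(s - t) * n)) * coverLimit T Z φ t ε)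
      atTop (𝓝 (ENNReal.ofReal 0 * coverLimit T Z φ t ε)) := by
    refine ENNReal.Tendsto.mul_const ?_ (Or.inr h)
    refine ENNReal.tendsto_ofReal (Real.tendsto_exp_atBot.comp ?_)
    exact tendsto_natCast_atTop_atTop.const_mul_atTop_of_neg (by linarith)
  have h2 := le_of_tendsto_of_tendsto' (tendsto_coverSum T Z φ s ε) h1 fun n =>
    (coverSum_le_of_lt T Z φ hts n ε).trans
      (mul_le_mul_right (le_iSup (fun n => coverSum T Z φ t n ε) n) _)
  simpa using h2

theorem pressureAt_eq_sSup (T : X → X) (Z : Set X) (φ : X → ℝ) (ε : ℝ) :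
    pressureAt T Z φ ε =
      sSup ((fun t : ℝ => (t : EReal)) '' {t : ℝ | coverLimit T Z φ t ε = ∞}) := by
  refine le_antisymm ?_ ?_
  · refine EReal.le_of_forall_lt_iff_le.1 fun c hc => ?_
    by_contra! hlt
    obtain ⟨c', hc', hc''⟩ := EReal.lt_iff_exists_real_btwn.1 hc
    have h1 : coverLimit T Z φ c' ε ≠ ∞ := fun h =>
      absurd (le_sSup (Set.mem_image_of_mem (fun t : ℝ => (t : EReal)) h)) (not_le.2 hc')
    have h2 := coverLimit_eq_zero_of_lt T Z φ (EReal.coe_lt_coe_iff.1 hc'') h1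
    exact absurd (sInf_le (Set.mem_image_of_mem (fun t : ℝ => (t : EReal)) h2)) (not_le.2 hlt)
  · refine sSup_le ?_
    rintro _ ⟨t, ht, rfl⟩
    refine le_sInf ?_
    rintro _ ⟨s, hs, rfl⟩
    by_contra! hst
    have h := coverLimit_eq_zero_of_lt T Z φ (EReal.coe_lt_coe_iff.1 hst)
      (by rw [show coverLimit T Z φ s ε = 0 from hs]; simp)
    rw [show coverLimit T Z φ t ε = ∞ from ht] at h
    simp at h

theorem birkhoffSum_le_add {T : X → X} {φ : X → ℝ} {δ V : ℝ} (hδ : 0 < δ)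
    (hV : ∀ x y, dist x y < δ → |φ x - φ y| ≤ V) {m : ℕ} {x y : X} (h : y ∈ bowenBall T m x δ) :
    |birkhoffSum T φ m x - birkhoffSum T φ m y| ≤ V * m := by
  have h' := (bowenDist_lt_iff T m x y hδ).1 h
  unfold birkhoffSum
  rw [← Finset.sum_sub_distrib]
  refine (Finset.abs_sum_le_sum_abs _ _).trans ?_
  refine (Finset.sum_le_sum (g := fun _ => V) fun i hi =>
    hV _ _ (h' i (Finset.mem_range.1 hi))).trans ?_
  simp [mul_comm]

theorem coverSum_le_coverSum {T : X → X} {Z : Set X} {φ : X → ℝ} {ε' ε V : ℝ} (hε' : 0 < ε')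
    (hlt : ε' ≤ ε) (hV : ∀ x y, dist x y < ε → |φ x - φ y| ≤ V) (t : ℝ) (n : ℕ) :
    coverSum T Z φ (t + V) n ε ≤ coverSum T Z φ t n ε' := by
  have hε := hε'.trans_le hlt
  have hsub : ∀ m x, bowenBall T m x ε' ⊆ bowenBall T m x ε := fun m x y hy =>
    lt_of_lt_of_le (show bowenDist T m x y < ε' from hy) hlt
  refine le_iInf₂ fun C hC => ?_
  refine (iInf₂_le C ⟨hC.1, hC.2.1, hC.2.2.trans (iUnion₂_mono fun p _ => hsub _ _)⟩).trans ?_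
  refine ENNReal.tsum_le_tsum fun p => ENNReal.ofReal_le_ofReal (Real.exp_le_exp.2 ?_)
  obtain ⟨⟨x, m⟩, hp⟩ := p
  have hx : ∀ r : ℝ, 0 < r → x ∈ bowenBall T m x r := fun r hr =>
    (bowenDist_lt_iff T m x x hr).2 (by simpa using fun _ _ => hr)
  have hb : ∀ y ∈ bowenBall T m x ε, birkhoffSum T φ m y ≤ birkhoffSum T φ m x + V * m :=
    fun y hy => by linarith [(abs_le.1 (birkhoffSum_le_add hε hV hy)).1]
  have h1 : sSup (birkhoffSum T φ m '' bowenBall T m x ε) ≤ birkhoffSum T φ m x + V * m := by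
    refine csSup_le ⟨_, Set.mem_image_of_mem _ (hx ε hε)⟩ ?_
    rintro _ ⟨y, hy, rfl⟩
    exact hb y hy
  have h2 : birkhoffSum T φ m x ≤ sSup (birkhoffSum T φ m '' bowenBall T m x ε') := by
    refine le_csSup ⟨birkhoffSum T φ m x + V * m, ?_⟩ (Set.mem_image_of_mem _ (hx ε' hε'))
    rintro _ ⟨y, hy, rfl⟩
    exact hb y (hsub m x hy)
  simp only
  linarith

theorem tendsto_pressureAt [CompactSpace X] (T : X → X) (Z : Set X) {φ : X → ℝ}
    (hφ : Continuous φ) :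
    Tendsto (pressureAt T Z φ) (𝓝[>] 0) (𝓝 (pressure T Z φ)) := by
  suffices h : ∃ c, Tendsto (pressureAt T Z φ) (𝓝[>] 0) (𝓝 c) by
    obtain ⟨c, hc⟩ := h
    have h2 := hc.limsup_eq
    unfold pressure
    rw [h2]
    exact hc
  refine tendsto_of_no_upcrossings (s := range fun q : ℚ => ((q : ℝ) : EReal))
    EReal.denseRange_ratCast ?_
  rintro _ ⟨a, rfl⟩ _ ⟨b, rfl⟩ hab ⟨hfa, hfb⟩
  have hab' : (a : ℝ) < b := EReal.coe_lt_coe_iff.1 hab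
  obtain ⟨δ, hδ, hu⟩ := Metric.uniformContinuous_iff.1
    (CompactSpace.uniformContinuous_of_continuous hφ) (b - a) (sub_pos.2 hab')
  obtain ⟨ε, hεb, hε0, hεδ⟩ := (hfb.and_eventually
    (Ioo_mem_nhdsGT hδ : Ioo (0 : ℝ) δ ∈ 𝓝[>] (0 : ℝ))).exists
  obtain ⟨ε', hεa, hε'0, hε'ε⟩ := (hfa.and_eventually
    (Ioo_mem_nhdsGT hε0 : Ioo (0 : ℝ) ε ∈ 𝓝[>] (0 : ℝ))).exists
  obtain ⟨_, ⟨t, ht, rfl⟩, hta⟩ := sInf_lt_iff.1 hεa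
  have hta' : t < a := EReal.coe_lt_coe_iff.1 hta
  have hz : coverLimit T Z φ (t + (b - a)) ε = 0 := by
    refine le_antisymm ?_ bot_le
    rw [← show coverLimit T Z φ t ε' = 0 from ht]
    refine iSup_mono fun n => coverSum_le_coverSum hε'0 hε'ε.le (fun x y hxy => ?_) t n
    exact (hu (hxy.trans hεδ)).le
  have hle : pressureAt T Z φ ε ≤ ((t + (b - a) : ℝ) : EReal) :=
    sInf_le (Set.mem_image_of_mem (fun t : ℝ => (t : EReal)) hz)
  have := EReal.coe_lt_coe_iff.1 (hεb.trans_le hle)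
  linarith

end TopDyn

end

namespace TopDyn

open MeasureTheory

/-! The upper bound holds for every subset: a maximal separated set is spanning, so Bowen balls of
one common length `n` around it cover, and replacing `S_n φ` by its supremum over a ball costs at
most `V n`, where `V` is the oscillation of `φ` at scale `ε` (`pressure_le_topPressure`).

For the lower bound, fix `u` outside the orbit closure of `z₀`. An orbit returning near `u` with
bounded gaps stays away from `z₀`: a close approach would make it follow the orbit of `z₀`, hence
miss `u`, for longer than a gap (`mem_nonDenseOrbitSet_of_periodic_visits`). Specification
concatenates arbitrary segments from a finite `(n, 4ε)`-separated set `E`, with a visit to `u` after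
each, which maps the full shift on `E` into `E(z₀)`. A Bowen ball determines the symbols of all
blocks it completely covers, so it pulls back into a cylinder, whose Bernoulli mass is at most a
constant times the weight of the ball. Summing over a cover bounds the cover sum away from zero
(`one_le_tsum_of_cylinder_cover`, `coverLimit_nonDenseOrbitSet_ne_zero`). -/

theorem ereal_coe_lt_log_div_iff {s : ℝ≥0∞} {n : ℕ} (hn : 0 < n) (c : ℝ) :
    (c : EReal) < ENNReal.log s / (n : EReal) ↔ ENNReal.ofReal (Real.exp (c * n)) < s := by
  rw [EReal.lt_div_iff (by exact_mod_cast hn) (EReal.natCast_ne_top n), ← ENNReal.log_lt_log_iff,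
    ENNReal.log_ofReal_of_pos (Real.exp_pos _), Real.log_exp]
  push_cast
  rfl

theorem log_div_lt_ereal_coe_iff {s : ℝ≥0∞} {n : ℕ} (hn : 0 < n) (c : ℝ) :
    ENNReal.log s / (n : EReal) < c ↔ s < ENNReal.ofReal (Real.exp (c * n)) := by
  rw [EReal.div_lt_iff (by exact_mod_cast hn) (EReal.natCast_ne_top n), ← ENNReal.log_lt_log_iff,
    ENNReal.log_ofReal_of_pos (Real.exp_pos _), Real.log_exp]
  push_cast
  rfl

/-! ### Separated sets and the upper bound -/

section Separated

variable {X : Type*} [MetricSpace X]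

theorem bowenDist_comm (T : X → X) (n : ℕ) (x y : X) : bowenDist T n x y = bowenDist T n y x := by
  simp only [bowenDist, dist_comm]

theorem bowenDist_self (T : X → X) (n : ℕ) (x : X) : bowenDist T n x x = 0 := by
  simp [bowenDist]

/-- A maximal `(n, ε)`-separated set is `(n, ε)`-spanning. -/
theorem exists_isSeparatedSet_spanning (T : X → X) (n : ℕ) {ε : ℝ} (hε : 0 ≤ ε) :
    ∃ E : Set X, IsSeparatedSet T n ε E ∧ ∀ x, ∃ y ∈ E, bowenDist T n y x ≤ ε := by
  obtain ⟨E, hE⟩ := zorn_subset {E : Set X | IsSeparatedSet T n ε E} (by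
    intro c hc hchain
    refine ⟨⋃₀ c, ?_, fun s hs => subset_sUnion_of_mem hs⟩
    rintro x ⟨s, hs, hxs⟩ y ⟨t, ht, hyt⟩ hxy
    rcases hchain.total hs ht with h | h
    · exact hc ht x (h hxs) y hyt hxy
    · exact hc hs x hxs y (h hyt) hxy)
  refine ⟨E, hE.prop, fun x => ?_⟩
  by_contra! hx
  have hins : IsSeparatedSet T n ε (insert x E) := by
    rintro a (rfl | ha) b (rfl | hb) hab
    · exact absurd rfl hab
    · rw [bowenDist_comm]
      exact hx b hb
    · exact hx a ha
    · exact hE.prop a ha b hb hab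
  have hxE : x ∈ E := hE.le_of_ge hins (subset_insert x E) (mem_insert x E)
  have := hx x hxE
  rw [bowenDist_self] at this
  linarith

theorem coverSum_le_separatedSum {T : X → X} {φ : X → ℝ} {ε' ε V : ℝ} (hε' : 0 < ε')
    (hlt : ε' < ε) (hV : ∀ x y, dist x y < ε → |φ x - φ y| ≤ V) (Z : Set X) (t : ℝ) (n : ℕ)
    (hfin : separatedSum T φ n ε' ≠ ∞) :
    coverSum T Z φ t n ε ≤ ENNReal.ofReal (Real.exp ((V - t) * n)) * separatedSum T φ n ε' := by
  have hε := hε'.trans hlt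
  obtain ⟨E, hE, hspan⟩ := exists_isSeparatedSet_spanning T n hε'.le
  have hle : ∑' x : E, ENNReal.ofReal (Real.exp (birkhoffSum T φ n x)) ≤ separatedSum T φ n ε' :=
    le_iSup₂ (f := fun (E : Set X) (_ : IsSeparatedSet T n ε' E) =>
      ∑' x : E, ENNReal.ofReal (Real.exp (birkhoffSum T φ n x))) E hE
  -- A finite sum of strictly positive terms has a countable index set.
  have hcount : E.Countable := by
    have h := Summable.countable_support_ennreal (ne_top_of_le_ne_top hfin hle)
    have h2 : (Function.support fun x : E =>
        ENNReal.ofReal (Real.exp (birkhoffSum T φ n x))) = univ := by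
      ext x
      simp [Real.exp_pos]
    rw [h2, countable_univ_iff] at h
    exact countable_coe_iff.1 h
  have hinj : Function.Injective fun x : X => (x, n) := fun x y h => (Prod.ext_iff.1 h).1
  have hcov : IsBowenCover T Z n ε ((fun x : X => (x, n)) '' E) := by
    refine ⟨hcount.image _, ?_, fun z _ => ?_⟩
    · rintro _ ⟨x, _, rfl⟩
      exact le_rfl
    · obtain ⟨y, hy, hyz⟩ := hspan z
      exact mem_iUnion₂.2 ⟨(y, n), mem_image_of_mem _ hy, hyz.trans_lt hlt⟩
  refine (iInf₂_le _ hcov).trans ?_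
  refine le_trans ?_ (mul_le_mul_right hle _)
  rw [← ENNReal.tsum_mul_left,
    tsum_image (fun p : X × ℕ => ballWeight T φ t ε p.1 p.2) hinj.injOn]
  refine ENNReal.tsum_le_tsum fun x => ?_
  unfold ballWeight
  rw [← ENNReal.ofReal_mul (Real.exp_pos _).le, ← Real.exp_add]
  refine ENNReal.ofReal_le_ofReal (Real.exp_le_exp.2 ?_)
  have h1 : sSup (birkhoffSum T φ n '' bowenBall T n x ε) ≤ birkhoffSum T φ n x + V * n := by
    refine csSup_le ⟨_, mem_image_of_mem _ (?_ : (x : X) ∈ bowenBall T n x ε)⟩ ?_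
    · exact (bowenDist_self T n x).trans_lt hε
    · rintro _ ⟨y, hy, rfl⟩
      linarith [(abs_le.1 (birkhoffSum_le_add hε hV hy)).1]
  linarith

/-- The liminf supplies good covers only for infinitely many `n`; this suffices because the cover
sums converge. -/
theorem pressureAt_le_of_topPressureAt_lt {T : X → X} {φ : X → ℝ} {ε' ε V c : ℝ} (hε' : 0 < ε')
    (hlt : ε' < ε) (hV : ∀ x y, dist x y < ε → |φ x - φ y| ≤ V) (Z : Set X)
    (hc : topPressureAt T φ ε' < c) : pressureAt T Z φ ε ≤ ((c + V : ℝ) : EReal) := by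
  refine EReal.le_of_forall_lt_iff_le.1 fun t ht => sInf_le (mem_image_of_mem _ ?_)
  have ht' : c + V < t := EReal.coe_lt_coe_iff.1 ht
  have hfreq : ∃ᶠ n : ℕ in atTop, coverSum T Z φ t n ε ≤
      ENNReal.ofReal (Real.exp ((c + V - t) * n)) := by
    refine ((frequently_lt_of_liminf_lt (by isBoundedDefault) hc).and_eventually
      (eventually_gt_atTop 0)).mono ?_
    rintro n ⟨hn, hn0⟩
    have hs := (log_div_lt_ereal_coe_iff hn0 c).1 hn
    refine (coverSum_le_separatedSum hε' hlt hV Z t n hs.ne_top).trans ?_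
    refine (mul_le_mul_right hs.le _).trans ?_
    rw [← ENNReal.ofReal_mul (Real.exp_pos _).le, ← Real.exp_add]
    exact ENNReal.ofReal_le_ofReal (Real.exp_le_exp.2 (by linarith))
  have hlim : Tendsto (fun n : ℕ => ENNReal.ofReal (Real.exp ((c + V - t) * n))) atTop (𝓝 0) := by
    rw [← ENNReal.ofReal_zero]
    refine ENNReal.tendsto_ofReal (Real.tendsto_exp_atBot.comp ?_)
    exact tendsto_natCast_atTop_atTop.const_mul_atTop_of_neg (by linarith)
  exact le_antisymm (le_of_tendsto_of_tendsto_of_frequently (tendsto_coverSum T Z φ t ε) hlim hfreq)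
    bot_le

/-- The Pesin–Pitskel pressure of any subset is at most the classical topological pressure. -/
theorem pressure_le_topPressure [CompactSpace X] (T : X → X) (Z : Set X) {φ : X → ℝ}
    (hφ : Continuous φ) : pressure T Z φ ≤ topPressure T φ := by
  refine EReal.le_of_forall_lt_iff_le.1 fun c hc => ?_
  obtain ⟨c', hc1, hc2⟩ := EReal.lt_iff_exists_real_btwn.1 hc
  have hc2' : c' < c := EReal.coe_lt_coe_iff.1 hc2
  obtain ⟨δ, hδ, hu⟩ := Metric.uniformContinuous_iff.1
    (CompactSpace.uniformContinuous_of_continuous hφ) (c - c') (sub_pos.2 hc2')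
  refine le_of_tendsto (tendsto_pressureAt T Z hφ) ?_
  have hlt := (tendsto_topPressureAt T φ).eventually (gt_mem_nhds hc1)
  filter_upwards [(Ioo_mem_nhdsGT hδ : Ioo (0 : ℝ) δ ∈ 𝓝[>] (0 : ℝ))] with ε hε
  obtain ⟨ε', h1, h2, h3⟩ := (hlt.and
    (Ioo_mem_nhdsGT hε.1 : Ioo (0 : ℝ) ε ∈ 𝓝[>] (0 : ℝ))).exists
  have := pressureAt_le_of_topPressureAt_lt (V := c - c') h2 h3
    (fun x y hxy => (hu (hxy.trans hε.2)).le) Z h1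
  simpa using this

theorem exists_finset_isSeparatedSet {T : X → X} {φ : X → ℝ} {n : ℕ} {ε : ℝ} {a : ℝ≥0∞}
    (h : a < separatedSum T φ n ε) :
    ∃ E : Finset X, IsSeparatedSet T n ε E ∧
      a < ∑ x ∈ E, ENNReal.ofReal (Real.exp (birkhoffSum T φ n x)) := by
  obtain ⟨E, hE⟩ := lt_iSup_iff.1 h
  obtain ⟨hsep, hE⟩ := lt_iSup_iff.1 hE
  rw [ENNReal.tsum_eq_iSup_sum] at hE
  obtain ⟨s, hs⟩ := lt_iSup_iff.1 hE
  refine ⟨s.map (Function.Embedding.subtype _), ?_, by simpa using hs⟩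
  intro x hx y hy hxy
  simp only [Finset.coe_map, Function.Embedding.subtype_apply, mem_image] at hx hy
  obtain ⟨x', -, rfl⟩ := hx
  obtain ⟨y', -, rfl⟩ := hy
  exact hsep _ x'.2 _ y'.2 hxy

end Separated

/-! ### Mass distribution on the full shift -/

/-- Cylinders covering a full shift have total Bernoulli mass at least one. -/
theorem one_le_tsum_of_cylinder_cover {α ι : Type*} [Fintype α] (w : α → ℝ≥0∞)
    (hw : 1 ≤ ∑ a, w a) (hw' : ∀ a, w a ≠ ∞) {C : Set ι} (hC : C.Countable)
    (S : ι → Set (ℕ → α)) (J : ι → ℕ) (f : ι → ℝ≥0∞) (hcov : ∀ x, ∃ i ∈ C, x ∈ S i)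
    (hcyl : ∀ i ∈ C, ∀ x ∈ S i, ∀ y ∈ S i, ∀ j < J i, x j = y j)
    (hf : ∀ i ∈ C, ∀ x ∈ S i, ∏ j ∈ Finset.range (J i), w (x j) ≤ f i) :
    1 ≤ ∑' i : C, f i := by
  let _ : MeasurableSpace α := ⊤
  have hW0 : ∑ a, w a ≠ 0 := (zero_lt_one.trans_le hw).ne'
  have hWt : ∑ a, w a ≠ ∞ := ENNReal.sum_ne_top.2 fun a _ => hw' a
  -- The total weight is at least one, so normalising only decreases the weights.
  let p : PMF α := PMF.ofFintype (fun a => w a * (∑ a, w a)⁻¹) (by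
    rw [← Finset.sum_mul, ENNReal.mul_inv_cancel hW0 hWt])
  have hp : ∀ a, p.toMeasure {a} ≤ w a := by
    intro a
    rw [PMF.toMeasure_apply_singleton p a (by trivial)]
    refine (mul_le_mul_right (ENNReal.inv_le_one.2 hw) (w a)).trans ?_
    rw [mul_one]
  let μ : Measure (ℕ → α) := Measure.infinitePi fun _ => p.toMeasure
  have hμ : ∀ i ∈ C, μ (S i) ≤ f i := by
    intro i hi
    rcases (S i).eq_empty_or_nonempty with h | ⟨x, hx⟩
    · simp [h]
    · refine le_trans ?_ (hf i hi x hx)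
      have hsub : S i ⊆ ((Finset.range (J i) : Finset ℕ) : Set ℕ).pi fun j => {x j} :=
        fun y hy j hj => hcyl i hi y hy x hx j (by simpa using hj)
      refine (measure_mono hsub).trans ?_
      rw [Measure.infinitePi_pi _ fun _ _ => by trivial]
      exact Finset.prod_le_prod' fun j _ => hp _
  have huniv : (univ : Set (ℕ → α)) ⊆ ⋃ i ∈ C, S i := fun x _ => by
    obtain ⟨i, hi, hx⟩ := hcov x
    exact mem_iUnion₂.2 ⟨i, hi, hx⟩
  -- Subadditivity holds for arbitrary sets, so the `S i` need not be measurable; in the application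
  -- they come from a coding map obtained by choice.
  calc 1 = μ univ := measure_univ.symm
    _ ≤ μ (⋃ i ∈ C, S i) := measure_mono huniv
    _ ≤ ∑' i : C, μ (S i) := measure_biUnion_le μ hC S
    _ ≤ ∑' i : C, f i := ENNReal.tsum_le_tsum fun i => hμ i i.2

theorem abs_birkhoffSum_le {Y : Type*} {T : Y → Y} {ψ : Y → ℝ} {M : ℝ} (hM : ∀ x, |ψ x| ≤ M) (n : ℕ) (x : Y) :
    |birkhoffSum T ψ n x| ≤ n * M := by
  unfold birkhoffSum
  refine (Finset.abs_sum_le_sum_abs _ _).trans ?_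
  refine (Finset.sum_le_sum fun i _ => hM _).trans ?_
  simp

/-! ### Shadowing with regular visits to a point -/

section Shadowing

variable {X : Type*} [MetricSpace X]

/-- On a compact space the specification property shadows infinitely many orbit segments. -/
theorem HasSpecification.exists_forall_dist_le [CompactSpace X] {T : X → X} (hT : Continuous T)
    (hspec : HasSpecification T) {ε : ℝ} (hε : 0 < ε) :
    ∃ m : ℕ, ∀ (a b : ℕ → ℕ) (x : ℕ → X), (∀ j, a j ≤ b j) → (∀ j, b j + m ≤ a (j + 1)) →
      ∃ y : X, ∀ j p, p ≤ b j - a j → dist (T^[p + a j] y) (T^[p] (x j)) ≤ ε := by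
  obtain ⟨m, hm⟩ := hspec ε hε
  refine ⟨m, fun a b x hab hba => ?_⟩
  -- Nonstrict inequalities make these nested sets closed, so compactness applies.
  let K : ℕ → Set X := fun k =>
    {y | ∀ j, j < k → ∀ p, p ≤ b j - a j → dist (T^[p + a j] y) (T^[p] (x j)) ≤ ε}
  have hclosed : ∀ k, IsClosed (K k) := by
    intro k
    simp only [K, Set.ofPred_forall]
    refine isClosed_iInter fun j => isClosed_iInter fun _ => isClosed_iInter fun p =>
      isClosed_iInter fun _ => ?_
    exact isClosed_le ((hT.iterate _).dist continuous_const) continuous_const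
  obtain ⟨y, hy⟩ := IsCompact.nonempty_iInter_of_sequence_nonempty_isCompact_isClosed K
    (fun k y hy j hj => hy j (hj.trans k.lt_succ_self))
    (fun k => by
      obtain ⟨y, hy⟩ := hm k a b x (fun j _ => hab j) (fun j _ => hba j)
      exact ⟨y, fun j hj p hp => (hy j hj p hp).le⟩)
    (hclosed 0).isCompact hclosed
  exact ⟨y, fun j p hp => mem_iInter.1 hy (j + 1) j j.lt_succ_self p hp⟩

/-- Orbit segments of length `n` can be shadowed with period `n + 2 m`, with a visit to a given
point `u` between any two consecutive ones. -/
theorem HasSpecification.exists_periodic_visits [CompactSpace X] {T : X → X} (hT : Continuous T)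
    (hspec : HasSpecification T) (u : X) {ε : ℝ} (hε : 0 < ε) :
    ∃ m : ℕ, ∀ (n : ℕ) (x : ℕ → X), ∃ y : X,
      (∀ j p, p ≤ n → dist (T^[p + j * (n + 2 * m)] y) (T^[p] (x j)) ≤ ε) ∧
      ∀ j, dist (T^[j * (n + 2 * m) + (n + m)] y) u ≤ ε := by
  obtain ⟨m, hm⟩ := hspec.exists_forall_dist_le hT hε
  refine ⟨m, fun n x => ?_⟩
  -- Even indices carry the segments; odd indices carry the one-point segment `u`, at offset `n + m`
  -- in each block.
  obtain ⟨y, hy⟩ := hm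
    (fun i => i / 2 * (n + 2 * m) + i % 2 * (n + m))
    (fun i => i / 2 * (n + 2 * m) + (n + i % 2 * m))
    (fun i => if i % 2 = 0 then x (i / 2) else u)
    (fun i => by rcases Nat.mod_two_eq_zero_or_one i with h | h <;> simp [h])
    (fun i => by
      rcases Nat.mod_two_eq_zero_or_one i with h | h
      · have h1 : (i + 1) % 2 = 1 := by omega
        have h2 : (i + 1) / 2 = i / 2 := by omega
        simp only [h, h1, h2]
        omega
      · have h1 : (i + 1) % 2 = 0 := by omega
        have h2 : (i + 1) / 2 = i / 2 + 1 := by omega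
        simp only [h, h1, h2, add_mul]
        omega)
  refine ⟨y, fun j p hp => ?_, fun j => ?_⟩
  · have h1 : 2 * j % 2 = 0 := by omega
    have h2 : 2 * j / 2 = j := by omega
    simpa [h1, h2] using hy (2 * j) p (by simpa [h1, h2] using hp)
  · have h1 : (2 * j + 1) % 2 = 1 := by omega
    have h2 : (2 * j + 1) / 2 = j := by omega
    simpa [h1, h2] using hy (2 * j + 1) 0 (Nat.zero_le _)

/-- If an orbit visits, with bounded gaps, a neighbourhood of a point away from the orbit of `z₀`,
then it stays away from `z₀`. -/
theorem mem_nonDenseOrbitSet_of_periodic_visits {T : X → X} (hT : Continuous T) {z₀ u y : X}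
    {ε η : ℝ} (hη : ∀ i, η ≤ dist u (T^[i] z₀)) (hεη : ε < η) {L q : ℕ} (hL : 0 < L)
    (hq : q ≤ L) (hy : ∀ j, dist (T^[j * L + q] y) u ≤ ε) : y ∈ nonDenseOrbitSet T z₀ := by
  intro hz
  have hev : ∀ᶠ w in 𝓝 z₀, ∀ i ∈ Finset.range (2 * L + 1),
      dist (T^[i] w) (T^[i] z₀) < η - ε := by
    rw [Filter.eventually_all_finset]
    intro i _
    exact (hT.iterate i).continuousAt.eventually (Metric.ball_mem_nhds _ (sub_pos.2 hεη))
  obtain ⟨_, hw, r, rfl⟩ := mem_closure_iff_nhds.1 hz _ hev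
  have h1 := Nat.div_add_mod r L
  have h2 := Nat.mod_lt r hL
  have h3 : (r / L + 1) * L + q = (L - r % L + q) + r := by
    rw [add_mul, one_mul, mul_comm (r / L) L]
    omega
  have h4 := hw (L - r % L + q) (Finset.mem_range.2 (by omega))
  simp only [← Function.iterate_add_apply] at h4
  have h5 := hy (r / L + 1)
  rw [h3] at h5
  have h6 := dist_triangle_left u (T^[L - r % L + q] z₀) (T^[L - r % L + q + r] y)
  linarith [hη (L - r % L + q)]

/-- The Birkhoff sum along an orbit that shadows segments of length `n` with period `n + g` is
bounded below by the Birkhoff sums along the segments. -/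
theorem sum_birkhoffSum_le_of_shadowing {T : X → X} {ψ : X → ℝ} {δ ε V M : ℝ} (hδ : 0 < δ)
    (hεδ : ε < δ) (hV : ∀ x y, dist x y < δ → |ψ x - ψ y| ≤ V) (hM : ∀ x, |ψ x| ≤ M)
    {n g : ℕ} {x : ℕ → X} {y : X}
    (hy : ∀ j p, p ≤ n → dist (T^[p + j * (n + g)] y) (T^[p] (x j)) ≤ ε) (J : ℕ) :
    ∑ j ∈ Finset.range J, birkhoffSum T ψ n (x j) ≤
      birkhoffSum T ψ (J * (n + g)) y + J * (V * n + g * M) := by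
  induction J with
  | zero => simp
  | succ J ih =>
    rw [Finset.sum_range_succ, add_mul, one_mul, birkhoffSum_add, birkhoffSum_add]
    have h1 : T^[J * (n + g)] y ∈ bowenBall T n (x J) δ := by
      refine (bowenDist_lt_iff T n _ _ hδ).2 fun i hi => ?_
      rw [← Function.iterate_add_apply, dist_comm]
      exact (hy J i hi.le).trans_lt hεδ
    have h2 := (abs_le.1 (birkhoffSum_le_add hδ hV h1)).2
    have h3 := (abs_le.1 (abs_birkhoffSum_le (T := T) hM g (T^[n] (T^[J * (n + g)] y)))).1
    push_cast
    linarith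

end Shadowing

/-! ### The lower bound -/

section LowerBound

variable {X : Type*} [MetricSpace X]

theorem birkhoffSum_sub_const {Y : Type*} (T : Y → Y) (φ : Y → ℝ) (c : ℝ) (n : ℕ) (x : Y) :
    birkhoffSum T (fun z => φ z - c) n x = birkhoffSum T φ n x - c * n := by
  simp [birkhoffSum, Finset.sum_sub_distrib, mul_comm]

/-- Under specification, below the critical value of the topological pressure the cover sums of
`E(z₀)` do not vanish. -/
theorem coverLimit_nonDenseOrbitSet_ne_zero [CompactSpace X] {T : X → X} (hT : Continuous T)
    (hspec : HasSpecification T) {z₀ u : X} {φ : X → ℝ} {ε δ η V M c c' : ℝ} (hε : 0 < ε)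
    (hη : ∀ i, η ≤ dist u (T^[i] z₀)) (hεη : ε < η) (hεδ : ε < δ)
    (hV : ∀ x y, dist x y < δ → |φ x - φ y| ≤ V) (hM : ∀ x, |φ x| ≤ M)
    (hc' : (c' : EReal) < topPressureAt T φ (4 * ε)) (hc : c + V < c') :
    coverLimit T (nonDenseOrbitSet T z₀) φ c ε ≠ 0 := by
  have hδ := hε.trans hεδ
  have hV0 : 0 ≤ V := (abs_nonneg _).trans (hV u u (by simpa using hδ))
  let ψ : X → ℝ := fun z => φ z - c'
  have hψV : ∀ x y, dist x y < δ → |ψ x - ψ y| ≤ V := fun x y h => by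
    simpa [ψ] using hV x y h
  have hψM : ∀ x, |ψ x| ≤ M + |c'| := fun x => (abs_sub _ _).trans (by linarith [hM x])
  have hψM0 : 0 ≤ M + |c'| := (abs_nonneg _).trans (hψM u)
  obtain ⟨m, hm⟩ := hspec.exists_periodic_visits hT u hε
  -- For large `n` the cost of the gaps in one block is absorbed by the slack `c' - V - c`.
  have hlarge : ∀ᶠ n : ℕ in atTop, 2 * m * (M + |c'|) ≤ (c' - V - c) * n :=
    (tendsto_natCast_atTop_atTop.const_mul_atTop (by linarith)).eventually_ge_atTop _
  obtain ⟨n, ⟨hsum, hn0⟩, hn⟩ := (((eventually_lt_of_lt_liminf hc' (by isBoundedDefault)).and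
    (eventually_gt_atTop 0)).and hlarge).exists
  obtain ⟨E, hE, hsumE⟩ := exists_finset_isSeparatedSet ((ereal_coe_lt_log_div_iff hn0 c').1 hsum)
  let w : E → ℝ≥0∞ := fun a => ENNReal.ofReal (Real.exp (birkhoffSum T ψ n a))
  have hw : 1 ≤ ∑ a, w a := by
    have h1 : ∀ a : E, w a = ENNReal.ofReal (Real.exp (birkhoffSum T φ n a)) *
        ENNReal.ofReal (Real.exp (-(c' * n))) := fun a => by
      simp only [w, ψ, birkhoffSum_sub_const]
      rw [← ENNReal.ofReal_mul (Real.exp_pos _).le, ← Real.exp_add, sub_eq_add_neg]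
    simp_rw [h1]
    rw [← Finset.sum_mul, Finset.sum_coe_sort E
      fun x => ENNReal.ofReal (Real.exp (birkhoffSum T φ n x))]
    refine le_trans ?_ (mul_le_mul_left hsumE.le _)
    rw [← ENNReal.ofReal_mul (Real.exp_pos _).le, ← Real.exp_add]
    simp
  choose y hy1 hy2 using fun x : ℕ → E => hm n fun j => x j
  set L := n + 2 * m with hL
  have hL0 : 0 < L := by omega
  have hyE : ∀ x, y x ∈ nonDenseOrbitSet T z₀ := fun x =>
    mem_nonDenseOrbitSet_of_periodic_visits hT hη hεη hL0 (by omega) (hy2 x)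
  -- `K` pays for the incomplete last block, of length `k % L < L`.
  let K : ℝ≥0∞ := ENNReal.ofReal (Real.exp (L * (M + |c'|)))
  have hK0 : K ≠ 0 := by simp [K, Real.exp_pos]
  suffices h : 1 ≤ K * coverSum T (nonDenseOrbitSet T z₀) φ c 0 ε by
    intro h0
    have h1 : coverSum T (nonDenseOrbitSet T z₀) φ c 0 ε = 0 :=
      le_antisymm ((le_iSup (fun n => coverSum T (nonDenseOrbitSet T z₀) φ c n ε) 0).trans h0.le)
        bot_le
    simp [h1] at h
  unfold coverSum
  rw [ENNReal.mul_iInf_of_ne hK0 ENNReal.ofReal_ne_top]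
  refine le_iInf fun C => ?_
  rw [ENNReal.mul_iInf_of_ne hK0 ENNReal.ofReal_ne_top]
  refine le_iInf fun hC => ?_
  rw [← ENNReal.tsum_mul_left]
  refine one_le_tsum_of_cylinder_cover w hw (fun _ => ENNReal.ofReal_ne_top) hC.1
    (fun p => {x | y x ∈ bowenBall T p.2 p.1 ε}) (fun p => p.2 / L)
    (fun p => K * ballWeight T φ c ε p.1 p.2) (fun x => ?_) ?_ ?_
  · obtain ⟨p, hp, hx⟩ := mem_iUnion₂.1 (hC.2.2 (hyE x))
    exact ⟨p, hp, hx⟩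
  · rintro ⟨z, k⟩ - x hx x' hx' j hj
    -- Different symbols would give `4ε`-separated segments, but both shadowing orbits are `ε`-close
    -- to that of `z` and to their own segments, a total below `4ε`.
    by_contra hne
    refine lt_asymm (hE _ (x j).2 _ (x' j).2 fun h => hne (Subtype.ext h)) ?_
    refine (bowenDist_lt_iff T n _ _ (by linarith)).2 fun i hi => ?_
    have hik : i + j * L < k := by
      have h1 : (j + 1) * L ≤ k := (Nat.mul_le_mul_right L hj).trans (Nat.div_mul_le_self k L)
      rw [add_mul] at h1
      omega
    have h1 := hy1 x j i hi.le
    rw [dist_comm] at h1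
    have h2 := hy1 x' j i hi.le
    have h3 := (bowenDist_lt_iff T k _ _ hε).1 hx _ hik
    have h4 := (bowenDist_lt_iff T k _ _ hε).1 hx' _ hik
    have h5 := dist_triangle4 (T^[i] (x j)) (T^[i + j * L] (y x)) (T^[i + j * L] (y x'))
      (T^[i] (x' j))
    have h6 := dist_triangle_left (T^[i + j * L] (y x)) (T^[i + j * L] (y x')) (T^[i + j * L] z)
    dsimp only at h3 h4
    linarith
  · rintro ⟨z, k⟩ - x hx
    simp only [w, K, ballWeight]
    rw [← ENNReal.ofReal_prod_of_nonneg fun _ _ => (Real.exp_pos _).le, ← Real.exp_sum,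
      ← ENNReal.ofReal_mul (Real.exp_pos _).le, ← Real.exp_add]
    refine ENNReal.ofReal_le_ofReal (Real.exp_le_exp.2 ?_)
    set J := k / L with hJ
    have h1 := sum_birkhoffSum_le_of_shadowing hδ hεδ hψV hψM (hy1 x) J
    have hk : J * L + k % L = k := Nat.div_add_mod' k L
    have h2 := birkhoffSum_add T ψ (J * L) (k % L) (y x)
    rw [hk, birkhoffSum_sub_const] at h2
    have h3 := (abs_le.1 (abs_birkhoffSum_le (T := T) hψM (k % L) (T^[J * L] (y x)))).1
    have h4 : ((k % L : ℕ) : ℝ) * (M + |c'|) ≤ L * (M + |c'|) :=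
      mul_le_mul_of_nonneg_right (by exact_mod_cast (Nat.mod_lt k hL0).le) hψM0
    have h5 : birkhoffSum T φ k (y x) ≤ sSup (birkhoffSum T φ k '' bowenBall T k z ε) := by
      refine le_csSup ⟨k * M, ?_⟩ (mem_image_of_mem _ hx)
      rintro _ ⟨v, -, rfl⟩
      exact (le_abs_self _).trans (abs_birkhoffSum_le hM k v)
    have h6 : (J : ℝ) * (V * n + (2 * m : ℕ) * (M + |c'|)) ≤ (c' - c) * k := by
      have hJk : ((J * n : ℕ) : ℝ) ≤ k := by
        refine Nat.cast_le.2 (le_trans (Nat.mul_le_mul_left J ?_) (Nat.div_mul_le_self k L))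
        omega
      calc (J : ℝ) * (V * n + (2 * m : ℕ) * (M + |c'|))
          ≤ J * ((c' - c) * n) := by
            refine mul_le_mul_of_nonneg_left ?_ J.cast_nonneg
            push_cast
            linarith
        _ = (c' - c) * (J * n : ℕ) := by push_cast; ring
        _ ≤ (c' - c) * k := mul_le_mul_of_nonneg_left hJk (by linarith)
    linarith

theorem topPressure_le_pressure_nonDenseOrbitSet [CompactSpace X] {T : X → X} (hT : Continuous T)
    (hspec : HasSpecification T) {z₀ : X} (hz₀ : IsNonTransitive T z₀) {φ : X → ℝ}
    (hφ : Continuous φ) : topPressure T φ ≤ pressure T (nonDenseOrbitSet T z₀) φ := by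
  refine EReal.ge_of_forall_gt_iff_ge.1 fun c hc => ?_
  obtain ⟨c', hc1, hc2⟩ := EReal.lt_iff_exists_real_btwn.1 hc
  have hc1' : c < c' := EReal.coe_lt_coe_iff.1 hc1
  obtain ⟨u, hu⟩ := (ne_univ_iff_exists_notMem _).1 hz₀
  obtain ⟨η, hη0, hη⟩ : ∃ η > 0, ∀ i, η ≤ dist u (T^[i] z₀) := by
    rw [Metric.mem_closure_iff] at hu
    push Not at hu
    obtain ⟨η, hη0, hη⟩ := hu
    exact ⟨η, hη0, fun i => hη _ (mem_range_self i)⟩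
  obtain ⟨M, hM⟩ : ∃ M, ∀ x, |φ x| ≤ M := by
    obtain ⟨M, hM⟩ := isCompact_univ.exists_bound_of_continuousOn hφ.continuousOn
    exact ⟨M, fun x => hM x (mem_univ x)⟩
  -- Half the gap between `c` and `c'` as oscillation bound `V` ensures `c + V < c'`.
  obtain ⟨δ, hδ, hmod⟩ := Metric.uniformContinuous_iff.1
    (CompactSpace.uniformContinuous_of_continuous hφ) ((c' - c) / 2) (by linarith)
  refine ge_of_tendsto (tendsto_pressureAt T _ hφ) ?_
  have h4 : Tendsto (fun ε : ℝ => 4 * ε) (𝓝[>] 0) (𝓝[>] 0) := by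
    refine tendsto_nhdsWithin_iff.2 ⟨?_, ?_⟩
    · simpa using ((continuous_const_mul (4 : ℝ)).tendsto 0).mono_left nhdsWithin_le_nhds
    · filter_upwards [self_mem_nhdsWithin] with ε hε
      simpa using hε
  filter_upwards [h4.eventually ((tendsto_topPressureAt T φ).eventually (lt_mem_nhds hc2)),
    (Ioo_mem_nhdsGT hδ : Ioo (0 : ℝ) δ ∈ 𝓝[>] (0 : ℝ)),
    (Ioo_mem_nhdsGT hη0 : Ioo (0 : ℝ) η ∈ 𝓝[>] (0 : ℝ))] with ε hε1 hε2 hε3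
  have hne := coverLimit_nonDenseOrbitSet_ne_zero (c := c) hT hspec hε2.1 hη hε3.2 hε2.2
    (fun x y h => (hmod h).le) hM hε1 (by linarith)
  refine le_sInf ?_
  rintro _ ⟨t, ht, rfl⟩
  by_contra! htc
  exact hne (coverLimit_eq_zero_of_lt T _ φ (EReal.coe_lt_coe_iff.1 htc)
    (by rw [show coverLimit T _ φ t ε = 0 from ht]; simp))

end LowerBound

end TopDyn

theorem theorem1p1 {X : Type*} [MetricSpace X] [CompactSpace X] (T : X → X) (hT : Continuous T)
    (hspec : TopDyn.HasSpecification T) (z₀ : X) (hz₀ : TopDyn.IsNonTransitive T z₀)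
    (φ : C(X, ℝ)) :
    TopDyn.nonDenseOrbitSet T z₀ = ∅ ∨
      TopDyn.pressure T (TopDyn.nonDenseOrbitSet T z₀) φ = TopDyn.topPressure T φ :=
  -- Equality holds outright, with no case split on emptiness.
  Or.inr (le_antisymm (TopDyn.pressure_le_topPressure T _ φ.continuous)
    (TopDyn.topPressure_le_pressure_nonDenseOrbitSet hT hspec hz₀ φ.continuous))
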